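/- A perfect secret sharing scheme realizing a finite graph $G=(V,E)$ is a collection of discrete random variables $\xi_v$ ($v\in V$, the shares) and $\xi_s$ (the secret) on a common probability space such that for every $A\subseteq V$: if $A$ contains both endpoints of some edge of $G$, then $(\xi_v)_{v\in A}$ determines $\xi_s$ with probability one; otherwise $(\xi_v)_{v\in A}$ is independent of $\xi_s$. Let $H$ denote Shannon entropy. The average information ratio of $G$ is $$\overline{\sigma}(G)=\inf_S \sum_{v\in V}\frac{H(\xi_v)}{H(\xi_s)\,|V|},$$ the infimum being over all perfect secret sharing schemes $S$ realizing $G$ with $0<H(\xi_s)<\infty$. For $d\ge 1$ let $\Delta_d$ be the family of all graphs obtained, up to isomorphism, as follows. Take three disjoint $d$-dimensional cubes $C^{(0)},C^{(1)},C^{(2)}$ (each on $2^d$ vertices), split the vertex set of each into two independent sets $C^{(i)}=A^{(i)}\cup B^{(i)}$ like a chessboard, and for each $i$ (indices modulo $3$) add the edges of an arbitrary perfect matching between $A^{(i)}$ and $B^{(i+1)}$. **Theorem.** Let $\delta\ge 2$ be an integer. Every graph $D_{\delta-1}\in\Delta_{\delta-1}$ is $\delta$-regular, has $3\cdot 2^{\delta-1}$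 vertices, and satisfies $$\overline{\sigma}(D_{\delta-1})=\frac{\delta+1}{2}.$$ -/

import Mathlib

open MeasureTheory ProbabilityTheory
open scoped ENNReal

namespace SecretSharing

/-- Shannon entropy `H(X) = -∑ₓ p(x) log p(x)`, `p(x) = P(X = x)`, of a random variable with values
in a (countable) type, as an element of `[0, ∞]`. The logarithm is the natural one; only ratios of
entropies are used below, so the base does not matter. -/
noncomputable def entropy {Ω α : Type*} [MeasurableSpace Ω] (P : Measure Ω) (X : Ω → α) : ℝ≥0∞ :=
  ∑' x, ENNReal.ofReal (Real.negMulLog (P.real (X ⁻¹' {x})))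

/-- A collection of discrete random variables `ξ_v` (the shares, `v ∈ V`) and `ξ_s` (the secret)
with a joint distribution. Possible values are coded by natural numbers. -/
structure Scheme (V : Type*) where
  Ω : Type
  [mΩ : MeasurableSpace Ω]
  P : Measure Ω
  [isProb : IsProbabilityMeasure P]
  share : V → Ω → ℕ
  secret : Ω → ℕ
  measurable_share : ∀ v, Measurable (share v)
  measurable_secret : Measurable secret

attribute [instance] Scheme.mΩ Scheme.isProb

variable {V : Type*}

/-- The joint random variable `(ξ_v : v ∈ A)`. -/
def Scheme.jointShare (S : Scheme V) (A : Set V) (ω : S.Ω) : A → ℕ :=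
  fun v => S.share v ω

/-- `S` is a perfect secret sharing scheme realizing the access structure `𝒜` (the family of
qualified subsets): a qualified set determines the secret (with probability one), and the shares of
an unqualified set are independent of the secret. -/
structure Scheme.Realizes (S : Scheme V) (𝒜 : Set (Set V)) : Prop where
  determines : ∀ A ∈ 𝒜, ∃ g : (A → ℕ) → ℕ, ∀ᵐ ω ∂S.P, S.secret ω = g (S.jointShare A ω)
  independent : ∀ A ∉ 𝒜, IndepFun (S.jointShare A) S.secret S.P

/-- The access structure of a graph: a set of vertices is qualified if it contains an edge. -/
def graphAccess (G : SimpleGraph V) : Set (Set V) :=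
  {A | ∃ u ∈ A, ∃ v ∈ A, G.Adj u v}

/-- The average information ratio of `G`: the infimum of `∑_v H(ξ_v) / (H(ξ_s) |V|)` over all
perfect secret sharing schemes realizing `G` for which the ratio makes sense, that is, whose
secret has positive finite entropy. -/
noncomputable def avgInfoRatio [Fintype V] (G : SimpleGraph V) : ℝ≥0∞ :=
  ⨅ (S : Scheme V) (_ : S.Realizes (graphAccess G))
    (_ : entropy S.P S.secret ≠ 0) (_ : entropy S.P S.secret ≠ ∞),
    ∑ v, entropy S.P (S.share v) / (entropy S.P S.secret * Fintype.card V)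

/-- The `d`-dimensional cube: 0-1 vectors of length `d`, adjacent when they differ in exactly one
coordinate. -/
def cube (d : ℕ) : SimpleGraph (Fin d → Bool) where
  Adj x y := hammingDist x y = 1
  symm := ⟨fun x y h => by rwa [hammingDist_comm]⟩
  loopless := ⟨fun x h => by simp at h⟩

/-- Three disjoint `d`-dimensional cubes, with vertices `(i, x)`, `i = 0, 1, 2` (indices modulo 3),
to which a perfect matching between `A i` in the cube `i` and the complement of `A (i + 1)` in the
cube `i + 1` is added for each `i`. -/
def cubeTriple (d : ℕ) (A : Fin 3 → Set (Fin d → Bool))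
    (M : (i : Fin 3) → A i ≃ ((A (i + 1))ᶜ : Set (Fin d → Bool))) :
    SimpleGraph (Fin 3 × (Fin d → Bool)) where
  Adj p q :=
    (p.1 = q.1 ∧ (cube d).Adj p.2 q.2) ∨
    (q.1 = p.1 + 1 ∧ ∃ h : p.2 ∈ A p.1, (M p.1 ⟨p.2, h⟩ : Fin d → Bool) = q.2) ∨
    (p.1 = q.1 + 1 ∧ ∃ h : q.2 ∈ A q.1, (M q.1 ⟨q.2, h⟩ : Fin d → Bool) = p.2)
  symm := ⟨by
    rintro p q (⟨h, h'⟩ | h | h)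
    · exact Or.inl ⟨h.symm, h'.symm⟩
    · exact Or.inr (Or.inr h)
    · exact Or.inr (Or.inl h)⟩
  loopless := ⟨by
    rintro ⟨i, x⟩ (⟨_, h⟩ | ⟨h, _⟩ | ⟨h, _⟩)
    · exact (cube d).loopless.irrefl x h
    · revert h; fin_cases i <;> simp
    · revert h; fin_cases i <;> simp⟩

/-- The family `Δ_d`, up to isomorphism: each of three disjoint cubes is split, like a chessboard,
into two independent sets `A i` and `B i = (A i)ᶜ`, and arbitrary perfect matchings between
`A i` and `B (i + 1)` are added. -/
def InDelta (d : ℕ) (G : SimpleGraph V) : Prop :=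
  ∃ (A : Fin 3 → Set (Fin d → Bool))
    (M : (i : Fin 3) → A i ≃ ((A (i + 1))ᶜ : Set (Fin d → Bool))),
    (∀ i, (cube d).IsIndepSet (A i) ∧ (cube d).IsIndepSet (A i)ᶜ) ∧
    Nonempty (G ≃g cubeTriple d A M)

end SecretSharing

/-! Write `d = δ - 1`, so that the claimed value is `(d + 2) / 2`.

Upper bound (`avgInfoRatio_le_of_isRegularOfDegree`). Cover `G` by the stars of all its vertices, so
that every edge lies in exactly two stars. The secret is a pair `(z₁, z₂)` over a prime field with
at least `|V|` elements, and the star of the `i`-th vertex distributes `z₁ + i z₂` ideally. An edge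
recovers two such values with distinct `i`, hence the pair. Each vertex takes part in `δ + 1` stars
while the secret has two field elements, which gives `(δ + 1) / 2`.

Lower bound (entropy method). Joint entropies of shares, divided by the entropy of the secret, form
a submodular function `f` with an extra unit in certain inequalities involving qualified and
unqualified sets (`IsGraphRank`). The matchings are arranged so that each cube has, in the other two
cubes, one pendant neighbour per vertex, and the pendants `p x` of its vertices outside `A` are
independent of each other and of the pendants `q x` of its vertices in `A` (`PendantCube`).

For a face `F` of the cube let `T` consist of the `A`-vertices of `F` and the pendants of its other
vertices; `T` is independent. Let `x ∈ A` contribute `f T - f (T \ x)` and `x ∉ A` contribute `f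
(xT) - f T`. For 0-dimensional faces the contributions are at most `f {x}`. Merging parallel
`k`-faces in pairs lowers the total by at least 1 for each of the `2 ^ d / 2` edges in the merging
direction (`term_succ_le`). For the whole cube each contribution is still at least 1. So the sum of
`f {x}` over one cube is at least `d * 2 ^ d / 2 + 2 ^ d`; adding up the three cubes gives the
bound. -/

namespace SecretSharing

/-! ### Shannon entropy: monotonicity, submodularity, independence, maximum. -/

section Entropy

variable {Ω α β γ : Type*} [MeasurableSpace Ω] {P : Measure Ω}

theorem entropy_congr {X Y : Ω → α} (h : X =ᵐ[P] Y) : entropy P X = entropy P Y := by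
  unfold entropy
  refine tsum_congr fun x => ?_
  rw [measureReal_congr (h.preimage {x})]

theorem entropy_comp_injective (X : Ω → α) {g : α → β} (hg : Function.Injective g) :
    entropy P (fun ω => g (X ω)) = entropy P X := by
  unfold entropy
  rw [← hg.tsum_eq]
  · refine tsum_congr fun x => ?_
    congr 4
    ext ω
    simp [hg.eq_iff]
  · intro y hy
    by_contra hne
    apply hy
    have : (fun ω => g (X ω)) ⁻¹' {y} = ∅ := by
      ext ω
      simp only [Set.mem_preimage, Set.mem_singleton_iff, Set.mem_empty_iff_false, iff_false]
      exact fun h => hne ⟨_, h⟩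
    simp [this]

theorem entropy_prodMk_of_determined {X : Ω → α} {Y : Ω → β} (g : α → β)
    (h : ∀ᵐ ω ∂P, Y ω = g (X ω)) : entropy P (fun ω => (X ω, Y ω)) = entropy P X := by
  rw [← entropy_comp_injective (P := P) X (g := fun x => (x, g x)) (fun x y hxy => by
    simpa using congrArg Prod.fst hxy)]
  refine entropy_congr ?_
  filter_upwards [h] with ω hω
  rw [hω]

theorem ae_measureReal_preimage_pos [Countable α] [IsFiniteMeasure P] (X : Ω → α) :
    ∀ᵐ ω ∂P, 0 < P.real (X ⁻¹' {X ω}) := by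
  have h : ∀ x, ∀ᵐ ω ∂P, X ω = x → 0 < P.real (X ⁻¹' {x}) := by
    intro x
    by_cases hx : 0 < P.real (X ⁻¹' {x})
    · exact Filter.Eventually.of_forall fun _ _ => hx
    · have h0 : P (X ⁻¹' {x}) = 0 := by
        have := le_antisymm (not_lt.1 hx) measureReal_nonneg
        rwa [measureReal_eq_zero_iff] at this
      filter_upwards [measure_eq_zero_iff_ae_notMem.1 h0] with ω hω he
      exact absurd he hω
  filter_upwards [ae_all_iff.2 h] with ω hω
  exact hω _ rfl

variable [Countable α] [MeasurableSpace α] [MeasurableSingletonClass α]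
  [Countable β] [MeasurableSpace β] [MeasurableSingletonClass β]
  [MeasurableSpace γ] [MeasurableSingletonClass γ]

theorem lintegral_comp_countable {X : Ω → α} (hX : Measurable X) (F : α → ℝ≥0∞) :
    ∫⁻ ω, F (X ω) ∂P = ∑' x, P (X ⁻¹' {x}) * F x := by
  rw [← lintegral_map (f := F) Measurable.of_discrete hX, lintegral_countable']
  refine tsum_congr fun x => ?_
  rw [Measure.map_apply hX (measurableSet_singleton x), mul_comm]

variable [IsProbabilityMeasure P]

theorem tsum_measure_preimage_singleton {X : Ω → α} (hX : Measurable X) :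
    ∑' x, P (X ⁻¹' {x}) = 1 := by
  simpa using (lintegral_comp_countable (P := P) hX (fun _ => 1)).symm

theorem entropy_eq_lintegral {X : Ω → α} (hX : Measurable X) :
    entropy P X = ∫⁻ ω, ENNReal.ofReal (-Real.log (P.real (X ⁻¹' {X ω}))) ∂P := by
  rw [lintegral_comp_countable hX (fun x => ENNReal.ofReal (-Real.log (P.real (X ⁻¹' {x}))))]
  refine tsum_congr fun x => ?_
  rw [Real.negMulLog, neg_mul_comm, ENNReal.ofReal_mul measureReal_nonneg, ofReal_measureReal]

/-- Entropy does not increase under a function. -/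
theorem entropy_comp_le {X : Ω → α} (hX : Measurable X) (u : α → β) :
    entropy P (fun ω => u (X ω)) ≤ entropy P X := by
  have hu : Measurable (fun ω => u (X ω)) := Measurable.of_discrete.comp hX
  rw [entropy_eq_lintegral hX, entropy_eq_lintegral hu]
  refine lintegral_mono_ae ?_
  filter_upwards [ae_measureReal_preimage_pos (P := P) X] with ω hω
  refine ENNReal.ofReal_le_ofReal (neg_le_neg (Real.log_le_log hω (measureReal_mono ?_)))
  intro ω' h
  simp only [Set.mem_preimage, Set.mem_singleton_iff] at h ⊢
  rw [h]

/-- Multiplying by the joint probability cancels the denominator, leaving at most the sum of `p(x)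
p(y) / p(z)` over pairs with `z = u x = v y`. Summing over `y` cancels `p(z)`, and the `p(x)` sum to
1. This is the analytic core of submodularity. -/
theorem lintegral_likelihood_ratio_le_one {X : Ω → α} {Y : Ω → β} (hX : Measurable X)
    (hY : Measurable Y) (u : α → γ) (v : β → γ) (h : ∀ ω, u (X ω) = v (Y ω)) :
    ∫⁻ ω, ENNReal.ofReal (P.real (X ⁻¹' {X ω}) * P.real (Y ⁻¹' {Y ω}) /
      (P.real ((fun ω => (X ω, Y ω)) ⁻¹' {(X ω, Y ω)}) *
        P.real ((fun ω => u (X ω)) ⁻¹' {u (X ω)}))) ∂P ≤ 1 := by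
  classical
  have hXY : Measurable (fun ω => (X ω, Y ω)) := hX.prodMk hY
  have hvm : Measurable (fun ω => v (Y ω)) := Measurable.of_discrete.comp hY
  have key := lintegral_comp_countable (P := P) hXY (fun z : α × β =>
    ENNReal.ofReal (P.real (X ⁻¹' {z.1}) * P.real (Y ⁻¹' {z.2}) /
      (P.real ((fun ω => (X ω, Y ω)) ⁻¹' {z}) * P.real ((fun ω => u (X ω)) ⁻¹' {u z.1}))))
  simp only at key
  rw [key]
  have hle : ∀ z : α × β, P ((fun ω => (X ω, Y ω)) ⁻¹' {z}) *
      ENNReal.ofReal (P.real (X ⁻¹' {z.1}) * P.real (Y ⁻¹' {z.2}) /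
      (P.real ((fun ω => (X ω, Y ω)) ⁻¹' {z}) * P.real ((fun ω => u (X ω)) ⁻¹' {u z.1}))) ≤
      P (X ⁻¹' {z.1}) * ((P ((fun ω => u (X ω)) ⁻¹' {u z.1}))⁻¹ *
        (if v z.2 = u z.1 then P (Y ⁻¹' {z.2}) else 0)) := by
    rintro ⟨x, y⟩
    by_cases h0 : P.real ((fun ω => (X ω, Y ω)) ⁻¹' {(x, y)}) = 0
    · simp [h0]
    have hne : ((fun ω => (X ω, Y ω)) ⁻¹' {(x, y)}).Nonempty := by
      by_contra hc
      rw [Set.not_nonempty_iff_eq_empty] at hc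
      simp [hc] at h0
    obtain ⟨ω, hω⟩ := hne
    obtain ⟨rfl, rfl⟩ := Prod.mk.inj hω
    have hpos : 0 < P.real ((fun ω => (X ω, Y ω)) ⁻¹' {(X ω, Y ω)}) :=
      lt_of_le_of_ne measureReal_nonneg (Ne.symm h0)
    have hzpos : 0 < P.real ((fun ω => u (X ω)) ⁻¹' {u (X ω)}) := by
      refine hpos.trans_le (measureReal_mono ?_)
      intro ω' hω'
      have := (Prod.mk.inj hω').1
      simp only [Set.mem_preimage, Set.mem_singleton_iff, this]
    rw [if_pos (h ω).symm]
    rw [← ofReal_measureReal (μ := P) (s := (fun ω => (X ω, Y ω)) ⁻¹' {(X ω, Y ω)}),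
      ← ENNReal.ofReal_mul measureReal_nonneg]
    have e : P.real ((fun ω => (X ω, Y ω)) ⁻¹' {(X ω, Y ω)}) *
        (P.real (X ⁻¹' {X ω}) * P.real (Y ⁻¹' {Y ω}) /
        (P.real ((fun ω => (X ω, Y ω)) ⁻¹' {(X ω, Y ω)}) *
          P.real ((fun ω => u (X ω)) ⁻¹' {u (X ω)}))) =
        P.real (X ⁻¹' {X ω}) * ((P.real ((fun ω => u (X ω)) ⁻¹' {u (X ω)}))⁻¹ *
          P.real (Y ⁻¹' {Y ω})) := by
      field_simp
    rw [e, ENNReal.ofReal_mul measureReal_nonneg,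
      ENNReal.ofReal_mul (inv_nonneg.2 measureReal_nonneg), ENNReal.ofReal_inv_of_pos hzpos,
      ofReal_measureReal, ofReal_measureReal, ofReal_measureReal]
  refine (ENNReal.tsum_le_tsum hle).trans ?_
  rw [ENNReal.tsum_prod']
  simp only [ENNReal.tsum_mul_left]
  have hsum : ∀ x, ∑' y, (if v y = u x then P (Y ⁻¹' {y}) else 0) =
      P ((fun ω => u (X ω)) ⁻¹' {u x}) := by
    intro x
    have := lintegral_comp_countable (P := P) hY (fun y => if v y = u x then 1 else 0)
    simp only [mul_ite, mul_one, mul_zero] at this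
    rw [← this]
    have e2 : (fun ω => if v (Y ω) = u x then (1 : ℝ≥0∞) else 0) =
        ((fun ω => v (Y ω)) ⁻¹' {u x}).indicator 1 := by
      ext ω
      simp [Set.indicator_apply]
    rw [e2, lintegral_indicator_one (hvm (measurableSet_singleton _))]
    simp only [h]
  simp only [hsum]
  rw [← tsum_measure_preimage_singleton (P := P) hX]
  refine ENNReal.tsum_le_tsum fun x => ?_
  exact mul_le_of_le_one_right' (ENNReal.inv_mul_le_one _)

/-- Submodularity of entropy. -/
theorem entropy_prodMk_add_le [Countable γ] {X : Ω → α} {Y : Ω → β} (hX : Measurable X) (hY : Measurable Y)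
    (u : α → γ) (v : β → γ) (h : ∀ ω, u (X ω) = v (Y ω)) :
    entropy P (fun ω => (X ω, Y ω)) + entropy P (fun ω => u (X ω)) ≤
      entropy P X + entropy P Y := by
  have hXY : Measurable (fun ω => (X ω, Y ω)) := hX.prodMk hY
  have hZ : Measurable (fun ω => u (X ω)) := Measurable.of_discrete.comp hX
  rw [entropy_eq_lintegral hX, entropy_eq_lintegral hY, entropy_eq_lintegral hXY,
    entropy_eq_lintegral hZ]
  have mX : Measurable (fun ω => ENNReal.ofReal (-Real.log (P.real (X ⁻¹' {X ω})))) :=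
    (Measurable.of_discrete (f := fun x =>
      ENNReal.ofReal (-Real.log (P.real (X ⁻¹' {x}))))).comp hX
  have mY : Measurable (fun ω => ENNReal.ofReal (-Real.log (P.real (Y ⁻¹' {Y ω})))) :=
    (Measurable.of_discrete (f := fun x =>
      ENNReal.ofReal (-Real.log (P.real (Y ⁻¹' {x}))))).comp hY
  have mXY : Measurable (fun ω => ENNReal.ofReal
      (-Real.log (P.real ((fun ω => (X ω, Y ω)) ⁻¹' {(X ω, Y ω)})))) :=
    (Measurable.of_discrete (f := fun x => ENNReal.ofReal
      (-Real.log (P.real ((fun ω => (X ω, Y ω)) ⁻¹' {x}))))).comp hXY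
  rw [← lintegral_add_left mXY, ← lintegral_add_left mX]
  -- To avoid subtraction in `[0, ∞]`, 1 is added to both sides, and on the right it is replaced by
  -- the smaller integral of the likelihood ratio `r`. What remains holds pointwise: `log r ≤ r -
  -- 1`.
  refine (ENNReal.add_le_add_iff_right ENNReal.one_ne_top).1 ?_
  refine le_trans ?_ (add_le_add_right (lintegral_likelihood_ratio_le_one (P := P) hX hY u v h) _)
  rw [← lintegral_add_left (show Measurable fun ω => ENNReal.ofReal
    (-Real.log (P.real (X ⁻¹' {X ω}))) + ENNReal.ofReal (-Real.log (P.real (Y ⁻¹' {Y ω})))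
    from mX.add mY)]
  have h1 : (1 : ℝ≥0∞) = ∫⁻ _, 1 ∂P := by simp
  conv_lhs => rw [h1]
  rw [← lintegral_add_right _ measurable_const]
  refine lintegral_mono_ae ?_
  filter_upwards [ae_measureReal_preimage_pos (P := P) X, ae_measureReal_preimage_pos (P := P) Y,
    ae_measureReal_preimage_pos (P := P) (fun ω => (X ω, Y ω)), ae_measureReal_preimage_pos (P := P) (fun ω => u (X ω))]
    with ω pX pY pXY pZ
  have nl : ∀ s : Set Ω, 0 ≤ -Real.log (P.real s) := fun s =>
    neg_nonneg.2 (Real.log_nonpos measureReal_nonneg measureReal_le_one)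
  rw [← ENNReal.ofReal_add (nl _) (nl _), ← ENNReal.ofReal_add (nl _) (nl _), ← ENNReal.ofReal_one,
    ← ENNReal.ofReal_add (add_nonneg (nl _) (nl _)) zero_le_one,
    ← ENNReal.ofReal_add (add_nonneg (nl _) (nl _)) (by positivity)]
  refine ENNReal.ofReal_le_ofReal ?_
  have hl := Real.log_le_sub_one_of_pos (div_pos (mul_pos pX pY) (mul_pos pXY pZ))
  rw [Real.log_div (mul_pos pX pY).ne' (mul_pos pXY pZ).ne', Real.log_mul pX.ne' pY.ne',
    Real.log_mul pXY.ne' pZ.ne'] at hl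
  linarith

theorem entropy_prodMk_of_indepFun {X : Ω → α} {Y : Ω → β} (hX : Measurable X) (hY : Measurable Y)
    (h : IndepFun X Y P) : entropy P (fun ω => (X ω, Y ω)) = entropy P X + entropy P Y := by
  have hm : ∀ x y, P.real ((fun ω => (X ω, Y ω)) ⁻¹' {(x, y)}) =
      P.real (X ⁻¹' {x}) * P.real (Y ⁻¹' {y}) := by
    intro x y
    have := h.measure_inter_preimage_eq_mul {x} {y} (measurableSet_singleton x)
      (measurableSet_singleton y)
    rw [measureReal_def, measureReal_def, measureReal_def, ← ENNReal.toReal_mul, ← this]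
    congr 2
    ext ω
    simp
  have nn : ∀ s : Set Ω, 0 ≤ Real.negMulLog (P.real s) := fun s =>
    Real.negMulLog_nonneg measureReal_nonneg measureReal_le_one
  unfold entropy
  rw [ENNReal.tsum_prod']
  simp only [hm, Real.negMulLog_mul]
  have : ∀ x y, ENNReal.ofReal (P.real (Y ⁻¹' {y}) * Real.negMulLog (P.real (X ⁻¹' {x})) +
      P.real (X ⁻¹' {x}) * Real.negMulLog (P.real (Y ⁻¹' {y}))) =
      P (Y ⁻¹' {y}) * ENNReal.ofReal (Real.negMulLog (P.real (X ⁻¹' {x}))) +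
      P (X ⁻¹' {x}) * ENNReal.ofReal (Real.negMulLog (P.real (Y ⁻¹' {y}))) := by
    intro x y
    rw [ENNReal.ofReal_add (mul_nonneg measureReal_nonneg (nn _))
      (mul_nonneg measureReal_nonneg (nn _)), ENNReal.ofReal_mul measureReal_nonneg,
      ENNReal.ofReal_mul measureReal_nonneg, ofReal_measureReal, ofReal_measureReal]
  simp only [this, ENNReal.tsum_add, ENNReal.tsum_mul_left, ENNReal.tsum_mul_right,
    tsum_measure_preimage_singleton hX, tsum_measure_preimage_singleton hY, one_mul]

/-- From `log t ≤ t - 1` at `t = 1 / (n p)`, each term satisfies `-p log p ≤ p log n + (1 / n - p)`,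
and the corrections `1 / n - p` sum to zero. -/
theorem entropy_le_log_card [Fintype α] {X : Ω → α} (hX : Measurable X) :
    entropy P X ≤ ENNReal.ofReal (Real.log (Fintype.card α)) := by
  have hne : Nonempty Ω := P.nonempty_of_neZero
  have hα : Nonempty α := hne.map X
  have hn : (0 : ℝ) < Fintype.card α := by exact_mod_cast Fintype.card_pos
  unfold entropy
  rw [tsum_fintype, ← ENNReal.ofReal_sum_of_nonneg fun x _ =>
    Real.negMulLog_nonneg measureReal_nonneg measureReal_le_one]
  refine ENNReal.ofReal_le_ofReal ?_
  have hs : ∑ x, P.real (X ⁻¹' {x}) = 1 := by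
    have := tsum_measure_preimage_singleton (P := P) hX
    rw [tsum_fintype] at this
    simp only [measureReal_def]
    rw [← ENNReal.toReal_sum (by simp), this, ENNReal.toReal_one]
  have hp : ∀ x, Real.negMulLog (P.real (X ⁻¹' {x})) ≤
      P.real (X ⁻¹' {x}) * Real.log (Fintype.card α) + (1 / Fintype.card α - P.real (X ⁻¹' {x})) := by
    intro x
    rcases (measureReal_nonneg (μ := P) (s := X ⁻¹' {x})).eq_or_lt with h0 | h0
    · rw [← h0]; simp
    · have hl := Real.log_le_sub_one_of_pos
        (x := 1 / (Fintype.card α * P.real (X ⁻¹' {x}))) (by positivity)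
      rw [one_div, Real.log_inv, Real.log_mul hn.ne' h0.ne'] at hl
      have := mul_le_mul_of_nonneg_left hl h0.le
      have e : P.real (X ⁻¹' {x}) * ((Fintype.card α * P.real (X ⁻¹' {x}))⁻¹ - 1) =
          1 / Fintype.card α - P.real (X ⁻¹' {x}) := by field_simp
      rw [e] at this
      rw [Real.negMulLog]
      nlinarith
  refine (Finset.sum_le_sum fun x _ => hp x).trans ?_
  rw [Finset.sum_add_distrib, Finset.sum_sub_distrib, ← Finset.sum_mul, hs]
  simp [hn.ne']

end Entropy

/-- The properties of the normalized entropy of the shares of a perfect secret sharing scheme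
realizing `G` that the entropy method uses. -/
structure IsGraphRank {V : Type*} (G : SimpleGraph V) (f : Set V → ℝ) : Prop where
  nonneg : ∀ A, 0 ≤ f A
  submod : ∀ A B, f (A ∪ B) + f (A ∩ B) ≤ f A + f B
  strict_mono : ∀ A B, A ⊆ B → A ∉ graphAccess G → B ∈ graphAccess G → f A + 1 ≤ f B
  strict_submod : ∀ A B, A ∈ graphAccess G → B ∈ graphAccess G → A ∩ B ∉ graphAccess G →
    f (A ∪ B) + f (A ∩ B) + 1 ≤ f A + f B

/-! ### From perfect schemes to rank functions. -/

namespace Scheme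

variable {V : Type*} (S : Scheme V)

theorem measurable_jointShare (A : Set V) : Measurable (S.jointShare A) :=
  measurable_pi_lambda _ fun v => S.measurable_share v

theorem entropy_jointShare_singleton (v : V) :
    entropy S.P (S.jointShare {v}) = entropy S.P (S.share v) := by
  rw [← entropy_comp_injective (P := S.P) (S.share v)
    (g := fun n => (fun _ => n : ({v} : Set V) → ℕ)) fun m n h => congrFun h ⟨v, rfl⟩]
  congr 1
  ext ω ⟨w, hw⟩
  rw [Set.mem_singleton_iff] at hw
  subst hw
  rfl

theorem Realizes.entropy_of_mem {S : Scheme V} {𝒜 : Set (Set V)} (hS : S.Realizes 𝒜) {A : Set V} (hA : A ∈ 𝒜) :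
    entropy S.P (fun ω => (S.jointShare A ω, S.secret ω)) = entropy S.P (S.jointShare A) := by
  obtain ⟨g, hg⟩ := hS.determines A hA
  exact entropy_prodMk_of_determined g hg

variable [Finite V]

/-- The extra variable `T` is the secret in the strict inequalities and a constant in the plain one.
-/
theorem entropy_jointShare_prod_union_add_inter_le {τ : Type*} [Countable τ] [MeasurableSpace τ]
    [MeasurableSingletonClass τ] {T : S.Ω → τ} (hT : Measurable T) (A B : Set V) :
    entropy S.P (fun ω => (S.jointShare (A ∪ B) ω, T ω)) +
      entropy S.P (fun ω => (S.jointShare (A ∩ B) ω, T ω)) ≤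
    entropy S.P (fun ω => (S.jointShare A ω, T ω)) +
      entropy S.P (fun ω => (S.jointShare B ω, T ω)) := by
  have h := entropy_prodMk_add_le (P := S.P) ((S.measurable_jointShare A).prodMk hT)
    ((S.measurable_jointShare B).prodMk hT)
    (fun z => ((fun v => z.1 ⟨v, v.2.1⟩ : (A ∩ B : Set V) → ℕ), z.2))
    (fun z => ((fun v => z.1 ⟨v, v.2.2⟩ : (A ∩ B : Set V) → ℕ), z.2)) (fun ω => rfl)
  refine le_trans (le_of_eq ?_) h
  congr 1
  let g : (((A ∪ B : Set V) → ℕ) × τ) → ((A → ℕ) × τ) × ((B → ℕ) × τ) := fun z =>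
    ((fun v => z.1 ⟨v, Or.inl v.2⟩, z.2), (fun v => z.1 ⟨v, Or.inr v.2⟩, z.2))
  have hg : Function.Injective g := by
    rintro ⟨x, s⟩ ⟨y, t⟩ hxy
    simp only [g, Prod.mk.injEq] at hxy
    obtain ⟨⟨h1, h2⟩, h3, -⟩ := hxy
    refine Prod.ext ?_ h2
    funext ⟨v, hv⟩
    rcases hv with hv | hv
    · exact congrFun h1 ⟨v, hv⟩
    · exact congrFun h3 ⟨v, hv⟩
  exact (entropy_comp_injective (P := S.P) _ hg).symm

theorem entropy_jointShare_union_add_inter_le (A B : Set V) :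
    entropy S.P (S.jointShare (A ∪ B)) + entropy S.P (S.jointShare (A ∩ B)) ≤
    entropy S.P (S.jointShare A) + entropy S.P (S.jointShare B) := by
  have h := S.entropy_jointShare_prod_union_add_inter_le
    (T := fun _ => ()) measurable_const A B
  have e : ∀ C : Set V, entropy S.P (fun ω => (S.jointShare C ω, ())) =
      entropy S.P (S.jointShare C) := fun C =>
    entropy_prodMk_of_determined (fun _ => ()) (Filter.Eventually.of_forall fun _ => rfl)
  simpa only [e] using h

theorem entropy_jointShare_ne_top (h : ∀ v, entropy S.P (S.share v) ≠ ∞) (A : Set V) :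
    entropy S.P (S.jointShare A) ≠ ∞ := by
  induction A, A.toFinite using Set.Finite.induction_on with
  | empty =>
    have := entropy_le_log_card (P := S.P) (S.measurable_jointShare ∅)
    exact ne_top_of_le_ne_top ENNReal.ofReal_ne_top this
  | @insert v B _ _ ih =>
    have h1 := S.entropy_jointShare_union_add_inter_le {v} B
    rw [entropy_jointShare_singleton] at h1
    rw [Set.insert_eq]
    exact ne_top_of_le_ne_top (ENNReal.add_ne_top.2 ⟨h v, ih⟩) (le_self_add.trans h1)

variable {S} {𝒜 : Set (Set V)}

theorem Realizes.entropy_of_notMem (hS : S.Realizes 𝒜) {A : Set V} (hA : A ∉ 𝒜) :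
    entropy S.P (fun ω => (S.jointShare A ω, S.secret ω)) =
      entropy S.P (S.jointShare A) + entropy S.P S.secret :=
  entropy_prodMk_of_indepFun (S.measurable_jointShare A) S.measurable_secret
    (hS.independent A hA)

theorem Realizes.entropy_add_le_of_subset (hS : S.Realizes 𝒜) {A B : Set V} (hAB : A ⊆ B)
    (hA : A ∉ 𝒜) (hB : B ∈ 𝒜) :
    entropy S.P (S.jointShare A) + entropy S.P S.secret ≤ entropy S.P (S.jointShare B) := by
  rw [← hS.entropy_of_notMem hA, ← hS.entropy_of_mem hB]
  exact entropy_comp_le (P := S.P) ((S.measurable_jointShare B).prodMk S.measurable_secret)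
    (fun z => ((fun v => z.1 ⟨v, hAB v.2⟩ : A → ℕ), z.2))

/-- Append the secret to all four terms of the submodular inequality: it is free on the qualified
`A`, `B`, `A ∪ B`, and costs a full `H(ξ_s)` on the unqualified `A ∩ B`. -/
theorem Realizes.entropy_union_add_inter_add_le (hS : S.Realizes 𝒜) (hmono : IsUpperSet 𝒜)
    {A B : Set V} (hA : A ∈ 𝒜) (hB : B ∈ 𝒜) (hAB : A ∩ B ∉ 𝒜) :
    entropy S.P (S.jointShare (A ∪ B)) + entropy S.P (S.jointShare (A ∩ B)) +
      entropy S.P S.secret ≤ entropy S.P (S.jointShare A) + entropy S.P (S.jointShare B) := by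
  have h := S.entropy_jointShare_prod_union_add_inter_le S.measurable_secret A B
  rwa [hS.entropy_of_mem hA, hS.entropy_of_mem hB,
    hS.entropy_of_mem (hmono Set.subset_union_left hA), hS.entropy_of_notMem hAB,
    ← add_assoc] at h

end Scheme

theorem isUpperSet_graphAccess {V : Type*} (G : SimpleGraph V) : IsUpperSet (graphAccess G) := by
  rintro A B hAB ⟨u, hu, v, hv, h⟩
  exact ⟨u, hAB hu, v, hAB hv, h⟩

theorem Scheme.Realizes.isGraphRank {V : Type*} [Finite V] {G : SimpleGraph V} {S : Scheme V}
    (hS : S.Realizes (graphAccess G)) (h0 : entropy S.P S.secret ≠ 0)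
    (h1 : entropy S.P S.secret ≠ ∞) (h : ∀ v, entropy S.P (S.share v) ≠ ∞) :
    IsGraphRank G fun A =>
      (entropy S.P (S.jointShare A)).toReal / (entropy S.P S.secret).toReal := by
  have hpos : 0 < (entropy S.P S.secret).toReal := ENNReal.toReal_pos h0 h1
  have ht := S.entropy_jointShare_ne_top h
  have hone : (1 : ℝ) = (entropy S.P S.secret).toReal / (entropy S.P S.secret).toReal :=
    (div_self hpos.ne').symm
  refine ⟨fun A => by positivity, fun A B => ?_, fun A B hAB hA hB => ?_,
    fun A B hA hB hAB => ?_⟩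
  · rw [← add_div, ← add_div]
    refine div_le_div_of_nonneg_right ?_ hpos.le
    rw [← ENNReal.toReal_add (ht _) (ht _), ← ENNReal.toReal_add (ht _) (ht _)]
    exact ENNReal.toReal_mono (ENNReal.add_ne_top.2 ⟨ht _, ht _⟩)
      (S.entropy_jointShare_union_add_inter_le A B)
  · rw [hone, ← add_div]
    refine div_le_div_of_nonneg_right ?_ hpos.le
    rw [← ENNReal.toReal_add (ht _) h1]
    exact ENNReal.toReal_mono (ht _) (hS.entropy_add_le_of_subset hAB hA hB)
  · rw [hone, ← add_div, ← add_div, ← add_div]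
    refine div_le_div_of_nonneg_right ?_ hpos.le
    rw [← ENNReal.toReal_add (ht _) (ht _), ← ENNReal.toReal_add (ht _) (ht _),
      ← ENNReal.toReal_add (ENNReal.add_ne_top.2 ⟨ht _, ht _⟩) h1]
    exact ENNReal.toReal_mono (ENNReal.add_ne_top.2 ⟨ht _, ht _⟩)
      (hS.entropy_union_add_inter_add_le (isUpperSet_graphAccess G) hA hB hAB)

/-! ### Rank functions on graphs: transport and the joining inequality. -/

section GraphRank

variable {V W : Type*} {G : SimpleGraph V} {f : Set V → ℝ}

theorem IsGraphRank.comap {T : SimpleGraph W} (hf : IsGraphRank G f) (φ : G ≃g T) :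
    IsGraphRank T fun A => f (φ ⁻¹' A) := by
  have h : ∀ A : Set W, φ ⁻¹' A ∈ graphAccess G ↔ A ∈ graphAccess T := by
    intro A
    constructor
    · rintro ⟨u, hu, v, hv, h⟩
      exact ⟨φ u, hu, φ v, hv, φ.map_adj_iff.2 h⟩
    · rintro ⟨u, hu, v, hv, h⟩
      exact ⟨φ.symm u, by simpa using hu, φ.symm v, by simpa using hv, φ.symm.map_adj_iff.2 h⟩
  refine ⟨fun A => hf.nonneg _, fun A B => hf.submod _ _, fun A B hAB hA hB => ?_,
    fun A B hA hB hAB => ?_⟩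
  · exact hf.strict_mono _ _ (Set.preimage_mono hAB) (mt (h A).1 hA) ((h B).2 hB)
  · exact hf.strict_submod _ _ ((h A).2 hA) ((h B).2 hB) (mt (h (A ∩ B)).1 hAB)

/-- The gain from joining `X` and `Y` along an edge `ba` with `a ∈ Y`, where `b` already sees a
vertex of `X`. -/
theorem IsGraphRank.join_add_one_le (hf : IsGraphRank G f) {a b p : V} {X Y : Set V} (hbY : b ∉ Y)
    (haX : a ∉ X) (haY : a ∈ Y) (hp : p ∈ X) (hbp : G.Adj b p) (hba : G.Adj b a)
    (hind : insert b (Y \ {a}) ∉ graphAccess G) :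
    f (insert b (X ∪ Y)) - f ((X ∪ Y) \ {a}) + 1 ≤
      (f (insert b X) - f X) + (f Y - f (Y \ {a})) := by
  have hpa : p ≠ a := fun h => haX (h ▸ hp)
  -- `h1` enlarges the set to which `b` is added from `X` to `(X ∪ Y) \ {a}`, and `h3` adds `b` to
  -- the set from which `a` is removed. The unit comes from `h2`: its two sets contain the edges
  -- `bp` and `ba`, but their intersection is independent.
  have h1 := hf.submod (insert b X) ((X ∪ Y) \ {a})
  have h2 := hf.strict_submod (insert b ((X ∪ Y) \ {a})) (insert b Y)
    ⟨b, by simp, p, by simp [hp, hpa], hbp⟩ ⟨b, by simp, a, by simp [haY], hba⟩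
  have h3 := hf.submod Y (insert b (Y \ {a}))
  have e1 : insert b X ∪ (X ∪ Y) \ {a} = insert b ((X ∪ Y) \ {a}) := by
    ext v; simp only [Set.mem_union, Set.mem_insert_iff, Set.mem_sdiff, Set.mem_singleton_iff]
    grind
  have e2 : insert b X ∩ ((X ∪ Y) \ {a}) = X := by
    ext v; simp only [Set.mem_union, Set.mem_inter_iff, Set.mem_insert_iff, Set.mem_sdiff,
      Set.mem_singleton_iff]
    grind
  have e3 : insert b ((X ∪ Y) \ {a}) ∪ insert b Y = insert b (X ∪ Y) := by
    ext v; simp only [Set.mem_union, Set.mem_insert_iff, Set.mem_sdiff, Set.mem_singleton_iff]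
    grind
  have e4 : insert b ((X ∪ Y) \ {a}) ∩ insert b Y = insert b (Y \ {a}) := by
    ext v; simp only [Set.mem_union, Set.mem_inter_iff, Set.mem_insert_iff, Set.mem_sdiff,
      Set.mem_singleton_iff]
    grind
  have e5 : Y ∪ insert b (Y \ {a}) = insert b Y := by
    ext v; simp only [Set.mem_union, Set.mem_insert_iff, Set.mem_sdiff, Set.mem_singleton_iff]
    grind
  have e6 : Y ∩ insert b (Y \ {a}) = Y \ {a} := by
    ext v; simp only [Set.mem_inter_iff, Set.mem_insert_iff, Set.mem_sdiff, Set.mem_singleton_iff]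
    grind
  rw [e1, e2] at h1
  rw [e3, e4] at h2
  rw [e5, e6] at h3
  have h2' := h2 hind
  linarith

end GraphRank

/-! ### Combinatorics of the cube and its faces. -/

/-- The neighbour of `x` in the cube in direction `k`. -/
def flip {d : ℕ} (k : Fin d) (x : Fin d → Bool) : Fin d → Bool :=
  Function.update x k (!x k)

theorem flip_flip {d : ℕ} (k : Fin d) (x : Fin d → Bool) : flip k (flip k x) = x := by
  ext j; by_cases h : j = k <;> simp [flip, Function.update_apply, h]

theorem flip_injective_direction {d : ℕ} {j k : Fin d} {x : Fin d → Bool} (h : flip j x = flip k x) :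
    j = k := by
  by_contra hne
  have := congrFun h j
  simp [flip, hne] at this

theorem cube_adj_iff {d : ℕ} {x y : Fin d → Bool} : (cube d).Adj x y ↔ ∃ k, y = flip k x := by
  change hammingDist x y = 1 ↔ _
  rw [hammingDist, Finset.card_eq_one]
  constructor
  · rintro ⟨k, hk⟩
    refine ⟨k, funext fun j => ?_⟩
    have := Finset.ext_iff.1 hk j
    simp only [Finset.mem_filter, Finset.mem_univ, true_and, Finset.mem_singleton] at this
    by_cases hj : j = k
    · subst hj
      simp only [flip, Function.update_self]
      have := this.2 rfl
      revert this
      cases x j <;> cases y j <;> simp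
    · have h := not_not.1 (mt this.1 hj)
      simp [flip, hj, h]
  · rintro ⟨k, rfl⟩
    refine ⟨k, ?_⟩
    ext j
    simp only [Finset.mem_filter, Finset.mem_univ, true_and, Finset.mem_singleton]
    by_cases hj : j = k
    · subst hj; simp [flip]
    · simp [flip, hj]

/-- `x` and `y` have the same coordinates from the `k`-th on. -/
def AgreeFrom {d : ℕ} (k : ℕ) (x y : Fin d → Bool) : Prop :=
  ∀ j : Fin d, k ≤ j → x j = y j

theorem agreeFrom_succ_iff {d : ℕ} (k : Fin d) (x y : Fin d → Bool) :
    AgreeFrom (k + 1) x y ↔ AgreeFrom k x y ∨ AgreeFrom k (flip k x) y := by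
  constructor
  · intro h
    by_cases hk : x k = y k
    · left
      intro j hj
      rcases hj.eq_or_lt with hj | hj
      · rwa [← Fin.ext hj]
      · exact h j hj
    · right
      intro j hj
      rcases hj.eq_or_lt with hj | hj
      · rw [← Fin.ext hj]
        revert hk
        simp only [flip, Function.update_self]
        cases x k <;> cases y k <;> simp
      · have : j ≠ k := fun h => by simp [h] at hj
        simpa [flip, this] using h j hj
  · rintro (h | h) j hj
    · exact h j (by omega)
    · have : j ≠ k := fun h => by simp [h] at hj
      simpa [flip, this] using h j (by omega)

/-- A `d`-dimensional cube `c` in `G`, split into independent sets `A` and `Aᶜ`, together with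
pendant edges from `x ∉ A` to `p x` and from `x ∈ A` to `q x`. -/
structure PendantCube {V : Type*} (G : SimpleGraph V) {d : ℕ} (A : Set (Fin d → Bool))
    (c p q : (Fin d → Bool) → V) : Prop where
  flip_mem_iff : ∀ k x, flip k x ∈ A ↔ x ∉ A
  c_injective : Function.Injective c
  p_ne_c : ∀ x y, p x ≠ c y
  adj_flip : ∀ k x, G.Adj (c x) (c (flip k x))
  exists_flip_of_adj : ∀ x y, G.Adj (c x) (c y) → ∃ k, y = flip k x
  adj_p : ∀ x ∉ A, G.Adj (c x) (p x)
  eq_of_adj_p : ∀ x, ∀ y ∉ A, G.Adj (c x) (p y) → x = y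
  not_adj_p_p : ∀ x ∉ A, ∀ y ∉ A, ¬G.Adj (p x) (p y)
  adj_q : ∀ x ∈ A, G.Adj (c x) (q x)
  eq_of_adj_q : ∀ x ∈ A, ∀ y, G.Adj (c y) (q x) → x = y
  not_adj_p_q : ∀ x ∈ A, ∀ y ∉ A, ¬G.Adj (p y) (q x)

/-! ### The potential argument for one cube with pendant edges. -/

namespace PendantCube

variable {V : Type*} {G : SimpleGraph V} {d : ℕ} {A : Set (Fin d → Bool)}
  {c p q : (Fin d → Bool) → V}

theorem sum_eq_sum_notMem (h : PendantCube G A c p q) [DecidablePred (· ∈ A)] (k : Fin d)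
    (g : (Fin d → Bool) → ℝ) : ∑ x, g x = ∑ x with x ∉ A, (g x + g (flip k x)) := by
  rw [Finset.sum_add_distrib, ← Finset.sum_filter_not_add_sum_filter Finset.univ (· ∈ A) g]
  congr 1
  refine Finset.sum_nbij' (flip k) (flip k) ?_ ?_ ?_ ?_ ?_
  · intro x hx
    simpa [h.flip_mem_iff] using hx
  · intro x hx
    simpa [h.flip_mem_iff] using hx
  · intro x _; exact flip_flip k x
  · intro x _; exact flip_flip k x
  · intro x _; rw [flip_flip]

/-- The vertices of `A`, and the pendant vertices of those not in `A`, in the `k`-dimensional face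
of `x`. -/
def face (A : Set (Fin d → Bool)) (c p : (Fin d → Bool) → V) (k : ℕ) (x : Fin d → Bool) : Set V :=
  c '' {y | y ∈ A ∧ AgreeFrom k x y} ∪ p '' {y | y ∉ A ∧ AgreeFrom k x y}

theorem c_mem_face (h : PendantCube G A c p q) {k : ℕ} {x y : Fin d → Bool} :
    c y ∈ face A c p k x ↔ y ∈ A ∧ AgreeFrom k x y := by
  constructor
  · rintro (⟨z, hz, he⟩ | ⟨z, hz, he⟩)
    · exact h.c_injective he ▸ hz
    · exact absurd he (h.p_ne_c _ _)
  · exact fun hy => Or.inl ⟨y, hy, rfl⟩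

theorem face_succ (k : Fin d) (x : Fin d → Bool) :
    face A c p (k + 1) x = face A c p k x ∪ face A c p k (flip k x) := by
  unfold face
  simp only [agreeFrom_succ_iff, and_or_left, Set.ofPred_or, Set.image_union]
  ext v
  simp only [Set.mem_union]
  tauto

theorem face_notMem (h : PendantCube G A c p q) (k : ℕ) (x : Fin d → Bool) :
    face A c p k x ∉ graphAccess G := by
  rintro ⟨u, hu, v, hv, huv⟩
  rcases hu with ⟨y, hy, rfl⟩ | ⟨y, hy, rfl⟩ <;> rcases hv with ⟨z, hz, rfl⟩ | ⟨z, hz, rfl⟩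
  · obtain ⟨j, rfl⟩ := h.exists_flip_of_adj _ _ huv
    exact (h.flip_mem_iff j y).1 hz.1 hy.1
  · exact hz.1 (h.eq_of_adj_p _ _ hz.1 huv ▸ hy.1)
  · exact hy.1 (h.eq_of_adj_p _ _ hy.1 huv.symm ▸ hz.1)
  · exact h.not_adj_p_p _ hy.1 _ hz.1 huv

theorem insert_notMem_graphAccess {S : Set V} {b : V} (hS : S ∉ graphAccess G)
    (hb : ∀ v ∈ S, ¬G.Adj b v) : insert b S ∉ graphAccess G := by
  rintro ⟨u, rfl | hu, v, rfl | hv, huv⟩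
  · exact G.irrefl huv
  · exact hb v hv huv
  · exact hb u hu huv.symm
  · exact hS ⟨u, hu, v, hv, huv⟩

/-- In the face opposite to `b` in direction `k`, the only cube neighbour of `b` is the deleted
`flip k b`, and the pendant of `b` belongs to the face of `b` itself. -/
theorem insert_face_diff_notMem (h : PendantCube G A c p q) (k : Fin d) (b : Fin d → Bool) :
    insert (c b) (face A c p k (flip k b) \ {c (flip k b)}) ∉ graphAccess G := by
  have hne : ¬ AgreeFrom k (flip k b) b := fun hag => by
    have := hag k le_rfl
    simp [flip] at this
  refine insert_notMem_graphAccess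
    (fun hmem => h.face_notMem k (flip k b) (isUpperSet_graphAccess G Set.sdiff_subset hmem)) ?_
  rintro v ⟨⟨y, hy, rfl⟩ | ⟨y, hy, rfl⟩, hv⟩ hadj
  · obtain ⟨j, rfl⟩ := h.exists_flip_of_adj _ _ hadj
    have hjk : j ≠ k := fun e => hv (by rw [e]; rfl)
    have := hy.2 k le_rfl
    simp [flip, hjk.symm] at this
  · exact hne (h.eq_of_adj_p _ _ hy.1 hadj ▸ hy.2)

open Classical in
/-- The contribution of `x` to the potential of the partition into `k`-dimensional faces. -/
noncomputable def term (f : Set V → ℝ) (A : Set (Fin d → Bool)) (c p : (Fin d → Bool) → V) (k : ℕ)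
    (x : Fin d → Bool) : ℝ :=
  if x ∈ A then f (face A c p k x) - f (face A c p k x \ {c x})
  else f (insert (c x) (face A c p k x)) - f (face A c p k x)

variable {f : Set V → ℝ}

/-- After merging, both ends of the edge see the same set `T`, so their contributions telescope to
`f (bT) - f (T \ a)`, where `a = flip k b`. This is the left side of `join_add_one_le`, with the two
old face sets as `X` and `Y`. -/
theorem term_succ_le (h : PendantCube G A c p q) (hf : IsGraphRank G f) (k : Fin d)
    {b : Fin d → Bool} (hb : b ∉ A) :
    term f A c p (k + 1) b + term f A c p (k + 1) (flip k b) + 1 ≤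
      term f A c p k b + term f A c p k (flip k b) := by
  have hfl : flip k b ∈ A := (h.flip_mem_iff k b).2 hb
  have hface : face A c p (k + 1) (flip k b) = face A c p (k + 1) b := by
    rw [face_succ, face_succ, flip_flip, Set.union_comm]
  have hne : ¬ AgreeFrom k b (flip k b) := fun hag => by
    have := hag k le_rfl
    simp [flip] at this
  simp only [term, if_neg hb, if_pos hfl, hface]
  have := hf.join_add_one_le (b := c b) (a := c (flip k b)) (p := p b) (X := face A c p k b)
    (Y := face A c p k (flip k b)) (fun hc => hb (h.c_mem_face.1 hc).1)
    (fun hc => hne (h.c_mem_face.1 hc).2)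
    (h.c_mem_face.2 ⟨hfl, fun _ _ => rfl⟩) (Or.inr ⟨b, ⟨hb, fun _ _ => rfl⟩, rfl⟩) (h.adj_p b hb)
    (h.adj_flip k b) (h.insert_face_diff_notMem k b)
  rw [← face_succ] at this
  linarith

theorem term_zero_le (hf : IsGraphRank G f) (x : Fin d → Bool) :
    term f A c p 0 x ≤ f {c x} := by
  have hag : ∀ y, AgreeFrom 0 x y ↔ y = x :=
    fun y => ⟨fun hy => funext fun j => (hy j (Nat.zero_le _)).symm, fun hy _ _ => by rw [hy]⟩
  unfold term
  split_ifs with hx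
  · have e : face A c p 0 x = {c x} := by
      ext v
      simp only [face, hag, Set.mem_union, Set.mem_image, Set.mem_ofPred_eq, Set.mem_singleton_iff]
      grind
    rw [e]
    linarith [hf.nonneg ({c x} \ {c x})]
  · have := hf.submod {c x} (face A c p 0 x)
    rw [← Set.insert_eq] at this
    linarith [hf.nonneg ({c x} ∩ face A c p 0 x)]

/-- If `x ∉ A`, adding `x` to the independent set `T` creates the edge to its pendant `p x`. If `x ∈
A`, submodularity lets `q x` be added to both `T` and `T \ {x}`; then only the first contains an
edge. -/
theorem one_le_term (h : PendantCube G A c p q) (hf : IsGraphRank G f) (x : Fin d → Bool) :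
    1 ≤ term f A c p d x := by
  have hag : ∀ y, AgreeFrom d x y := fun y j hj => absurd j.2 (not_lt.2 hj)
  have hT := h.face_notMem d x
  unfold term
  split_ifs with hx
  · set T := face A c p d x with hTdef
    have hcx : c x ∈ T := h.c_mem_face.2 ⟨hx, hag x⟩
    have hq : q x ∉ T := by
      intro hmem
      exact hT ⟨c x, hcx, q x, hmem, h.adj_q x hx⟩
    have h1 := hf.submod T (insert (q x) (T \ {c x}))
    have e1 : T ∪ insert (q x) (T \ {c x}) = insert (q x) T := by
      ext v; simp only [Set.mem_union, Set.mem_insert_iff, Set.mem_sdiff, Set.mem_singleton_iff]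
      grind
    have e2 : T ∩ insert (q x) (T \ {c x}) = T \ {c x} := by
      ext v; simp only [Set.mem_inter_iff, Set.mem_insert_iff, Set.mem_sdiff, Set.mem_singleton_iff]
      grind
    have h2 := hf.strict_mono (insert (q x) (T \ {c x})) (insert (q x) T)
      (Set.insert_subset_insert Set.sdiff_subset)
      (insert_notMem_graphAccess
        (fun hm => hT (isUpperSet_graphAccess G Set.sdiff_subset hm)) (by
        rintro v ⟨⟨y, hy, rfl⟩ | ⟨y, hy, rfl⟩, hv⟩ hadj
        · exact hv (by rw [h.eq_of_adj_q x hx y hadj.symm]; rfl)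
        · exact h.not_adj_p_q x hx y hy.1 hadj.symm))
      ⟨c x, Or.inr hcx, q x, Or.inl rfl, h.adj_q x hx⟩
    rw [e1, e2] at h1
    linarith
  · have := hf.strict_mono (face A c p d x) (insert (c x) (face A c p d x))
      (Set.subset_insert _ _) hT
      ⟨c x, Or.inl rfl, p x, Or.inr (Or.inr ⟨x, ⟨hx, hag x⟩, rfl⟩), h.adj_p x hx⟩
    linarith

theorem sum_term_succ_le (h : PendantCube G A c p q) (hf : IsGraphRank G f) (k : Fin d) :
    ∑ x, term f A c p (k + 1) x + 2 ^ d / 2 ≤ ∑ x, term f A c p k x := by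
  classical
  -- Pairing along direction `k` shows that exactly half of the vertices lie outside `A`.
  have hcard : (2 : ℝ) ^ d / 2 = ∑ x with x ∉ A, 1 := by
    have := h.sum_eq_sum_notMem k (fun _ => 1 / 2)
    simp only [Finset.sum_const, Finset.card_univ, Fintype.card_pi, Fintype.card_bool,
      Finset.prod_const, Fintype.card_fin, nsmul_eq_mul] at this ⊢
    push_cast at this
    linarith
  rw [hcard, h.sum_eq_sum_notMem k, h.sum_eq_sum_notMem k, ← Finset.sum_add_distrib]
  exact Finset.sum_le_sum fun b hb => h.term_succ_le hf k (Finset.mem_filter.1 hb).2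

/-- The lower bound of the entropy method for a cube with pendant edges. -/
theorem le_sum (h : PendantCube G A c p q) (hf : IsGraphRank G f) :
    ((d : ℝ) + 2) / 2 * 2 ^ d ≤ ∑ x, f {c x} := by
  have hk : ∀ k ≤ d, ∑ x, term f A c p k x + k * (2 ^ d / 2) ≤ ∑ x, f {c x} := by
    intro k
    induction k with
    | zero =>
      intro _
      simpa using Finset.sum_le_sum fun x _ => term_zero_le hf x
    | succ k ih =>
      intro hk
      have h1 := ih (by omega)
      have h2 := h.sum_term_succ_le hf ⟨k, hk⟩
      simp only at h2
      push_cast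
      linarith
  have h1 := hk d le_rfl
  have h2 : (2 : ℝ) ^ d ≤ ∑ x, term f A c p d x := by
    have := Finset.sum_le_sum (s := Finset.univ) fun x _ => h.one_le_term hf x
    simpa using this
  linarith

end PendantCube

/-! ### Each of the three cubes has pendant edges in the other two. -/

section CubeTriple

variable {d : ℕ} {A : Fin 3 → Set (Fin d → Bool)}
  {M : (i : Fin 3) → A i ≃ ((A (i + 1))ᶜ : Set (Fin d → Bool))}

theorem flip_mem_iff {A : Set (Fin d → Bool)}
    (hA : (cube d).IsIndepSet A ∧ (cube d).IsIndepSet Aᶜ) (k : Fin d) (x : Fin d → Bool) :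
    flip k x ∈ A ↔ x ∉ A := by
  have hadj : (cube d).Adj x (flip k x) := cube_adj_iff.2 ⟨k, rfl⟩
  constructor
  · exact fun h1 h2 => hA.1 h2 h1 hadj.ne hadj
  · intro h1
    by_contra h2
    exact hA.2 h1 h2 hadj.ne hadj

-- For cube `i + 1` the pendants `p` lie in `A i` and the pendants `q` in the complement of `A (i +
-- 2)`. Edges between cubes `i + 2` and `i` run from `A (i + 2)` to the complement of `A i`, so none
-- joins a `p` to a `q`. The `else` values are placeholders: off the matched class only the cube
-- index matters.
open Classical in
theorem pendantCube_cubeTriple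
    (hA : ∀ i, (cube d).IsIndepSet (A i) ∧ (cube d).IsIndepSet (A i)ᶜ) (i : Fin 3) :
    PendantCube (cubeTriple d A M) (A (i + 1)) (fun x => (i + 1, x))
      (fun x => (i, if h : x ∈ (A (i + 1))ᶜ then (M i).symm ⟨x, h⟩ else x))
      (fun x => (i + 1 + 1, if h : x ∈ A (i + 1) then M (i + 1) ⟨x, h⟩ else x)) := by
  have n1 : ∀ j : Fin 3, j ≠ j + 1 := by decide
  have n2 : ∀ j : Fin 3, j ≠ j + 1 + 1 := by decide
  have n3 : ∀ j : Fin 3, j + 1 + 1 + 1 = j := by decide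
  refine ⟨flip_mem_iff (hA _), ?_, ?_, ?_, ?_, ?_, ?_, ?_, ?_, ?_, ?_⟩
  · intro x y hxy
    exact (Prod.mk.inj hxy).2
  · intro x y hxy
    exact n1 i (Prod.mk.inj hxy).1
  · intro k x
    exact Or.inl ⟨rfl, cube_adj_iff.2 ⟨k, rfl⟩⟩
  · rintro x y (⟨-, h⟩ | ⟨h, -⟩ | ⟨h, -⟩)
    · exact cube_adj_iff.1 h
    · exact absurd h (n1 _)
    · exact absurd h (n1 _)
  · intro x hx
    refine Or.inr (Or.inr ⟨rfl, ?_⟩)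
    simp [hx]
  · rintro x y hy (⟨h, -⟩ | ⟨h, -⟩ | ⟨h, h1, h2⟩)
    · exact absurd h.symm (n1 _)
    · exact absurd h (n2 _)
    · have hy' : y ∈ (A (i + 1))ᶜ := hy
      simp only [hy', dif_pos, Subtype.coe_eta, Equiv.apply_symm_apply] at h2
      exact h2.symm
  · rintro x hx y hy (⟨-, h⟩ | ⟨h, -⟩ | ⟨h, -⟩)
    · have hx' : x ∈ (A (i + 1))ᶜ := hx
      have hy' : y ∈ (A (i + 1))ᶜ := hy
      simp only [hx', hy', dif_pos] at h
      exact (hA i).1 (Subtype.coe_prop _) (Subtype.coe_prop _) h.ne h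
    · exact absurd h (n1 _)
    · exact absurd h (n1 _)
  · intro x hx
    refine Or.inr (Or.inl ⟨rfl, hx, ?_⟩)
    simp [hx]
  · rintro x hx y (⟨h, -⟩ | ⟨h, h1, h2⟩ | ⟨h, -⟩)
    · exact absurd h (n1 _)
    · simp only [hx, dif_pos] at h2
      have := (M (i + 1)).injective (Subtype.ext h2)
      exact (congrArg Subtype.val this).symm
    · exact absurd h (n2 _)
  · rintro x hx y hy (⟨h, -⟩ | ⟨h, -⟩ | ⟨h, h1, h2⟩)
    · exact absurd h (n2 _)
    · exact absurd h.symm (n1 _)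
    · have hx' : x ∈ A (i + 1) := hx
      simp only [hx', dif_pos] at h1
      exact (M (i + 1) ⟨x, hx'⟩).2 h1

theorem le_sum_cubeTriple (hA : ∀ i, (cube d).IsIndepSet (A i) ∧ (cube d).IsIndepSet (A i)ᶜ)
    {f : Set (Fin 3 × (Fin d → Bool)) → ℝ} (hf : IsGraphRank (cubeTriple d A M) f) :
    3 * (((d : ℝ) + 2) / 2 * 2 ^ d) ≤ ∑ v, f {v} := by
  -- The bound is available for cube `i + 1`, hence the cyclic shift of the index.
  rw [Fintype.sum_prod_type, ← Equiv.sum_comp (Equiv.addRight (1 : Fin 3))]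
  have := Finset.sum_le_sum (s := (Finset.univ : Finset (Fin 3))) fun i _ =>
    (pendantCube_cubeTriple (M := M) hA i).le_sum hf
  simpa using this

end CubeTriple

/-! ### Independence and entropy under the uniform distribution. -/

section Uniform

theorem nonempty_of_equiv_prod {Ω α β : Type*} [Nonempty Ω] (E : Ω ≃ α × β) : Nonempty α ∧ Nonempty β :=
  ⟨⟨(E (Classical.arbitrary Ω)).1⟩, ⟨(E (Classical.arbitrary Ω)).2⟩⟩

variable {Ω α β : Type*} [Fintype Ω] [MeasurableSpace Ω] [MeasurableSingletonClass Ω]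
  [Fintype α] [Fintype β]

theorem uniformOn_univ_real (s : Set Ω) :
    (uniformOn (Set.univ : Set Ω)).real s = s.ncard / Fintype.card Ω := by
  rw [measureReal_def, uniformOn_univ, Measure.count_apply s.toFinite.measurableSet,
    ← s.toFinite.cast_ncard_eq, ENat.toENNReal_coe, ENNReal.toReal_div, ENNReal.toReal_natCast,
    ENNReal.toReal_natCast]

theorem uniformOn_univ_real_inter_preimage (E : Ω ≃ α × β) (B : Set α) (C : Set β) :
    (uniformOn (Set.univ : Set Ω)).real
      ((fun ω => (E ω).1) ⁻¹' B ∩ (fun ω => (E ω).2) ⁻¹' C) =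
    (B.ncard / Fintype.card α) * (C.ncard / Fintype.card β) := by
  have e : (fun ω => (E ω).1) ⁻¹' B ∩ (fun ω => (E ω).2) ⁻¹' C = E ⁻¹' (B ×ˢ C) := rfl
  rw [uniformOn_univ_real, e, Set.ncard_preimage_of_injective_subset_range E.injective (by simp),
    Set.ncard_prod, Fintype.card_congr E, Fintype.card_prod]
  push_cast
  rw [div_mul_div_comm]

variable [Nonempty Ω] (E : Ω ≃ α × β)

theorem uniformOn_univ_real_preimage_fst (B : Set α) :
    (uniformOn (Set.univ : Set Ω)).real ((fun ω => (E ω).1) ⁻¹' B) =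
      B.ncard / Fintype.card α := by
  obtain ⟨_, _⟩ := nonempty_of_equiv_prod E
  have := uniformOn_univ_real_inter_preimage E B Set.univ
  simpa [Set.ncard_univ, Fintype.card_ne_zero] using this

theorem uniformOn_univ_real_preimage_snd (C : Set β) :
    (uniformOn (Set.univ : Set Ω)).real ((fun ω => (E ω).2) ⁻¹' C) =
      C.ncard / Fintype.card β := by
  obtain ⟨_, _⟩ := nonempty_of_equiv_prod E
  have := uniformOn_univ_real_inter_preimage E Set.univ C
  simpa [Set.ncard_univ, Fintype.card_ne_zero] using this

theorem indepFun_uniformOn_univ {γ δ : Type*} [MeasurableSpace γ] [MeasurableSpace δ]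
    (φ : β → γ) (ψ : α → δ) :
    IndepFun (fun ω => φ (E ω).2) (fun ω => ψ (E ω).1) (uniformOn (Set.univ : Set Ω)) := by
  rw [indepFun_iff_measure_inter_preimage_eq_mul]
  intro s t _ _
  have : IsProbabilityMeasure (uniformOn (Set.univ : Set Ω)) :=
    isProbabilityMeasure_uniformOn Set.finite_univ Set.univ_nonempty
  rw [← ENNReal.toReal_eq_toReal_iff' (measure_ne_top _ _)
    (ENNReal.mul_ne_top (measure_ne_top _ _) (measure_ne_top _ _)), ENNReal.toReal_mul]
  have h1 := uniformOn_univ_real_inter_preimage E (ψ ⁻¹' t) (φ ⁻¹' s)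
  have h2 := uniformOn_univ_real_preimage_fst E (ψ ⁻¹' t)
  have h3 := uniformOn_univ_real_preimage_snd E (φ ⁻¹' s)
  rw [Set.inter_comm, ← h2, ← h3] at h1
  rw [mul_comm] at h1
  exact h1

theorem entropy_uniformOn_univ_fst :
    entropy (uniformOn (Set.univ : Set Ω)) (fun ω => (E ω).1) =
      ENNReal.ofReal (Real.log (Fintype.card α)) := by
  obtain ⟨_, _⟩ := nonempty_of_equiv_prod E
  have hc : (Fintype.card α : ℝ) ≠ 0 := by exact_mod_cast Fintype.card_ne_zero
  unfold entropy
  simp only [uniformOn_univ_real_preimage_fst, Set.ncard_singleton, tsum_fintype,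
    Finset.sum_const, Finset.card_univ, nsmul_eq_mul]
  rw [← ENNReal.ofReal_natCast, ← ENNReal.ofReal_mul (Nat.cast_nonneg _), Real.negMulLog]
  congr 1
  rw [Nat.cast_one, one_div, Real.log_inv]
  field_simp

end Uniform

theorem entropy_comp_le_log_card {Ω α β : Type*} [MeasurableSpace Ω] {P : Measure Ω}
    [IsProbabilityMeasure P] [Countable β] [MeasurableSpace β] [MeasurableSingletonClass β]
    [Fintype α] (U : Ω → α) (hU : ∀ s : Set α, MeasurableSet (U ⁻¹' s)) (g : α → β) :
    entropy P (fun ω => g (U ω)) ≤ ENNReal.ofReal (Real.log (Fintype.card α)) := by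
  let : MeasurableSpace α := ⊤
  have hm : Measurable U := fun s _ => hU s
  exact (entropy_comp_le hm g).trans (entropy_le_log_card hm)

/-! ### The upper bound: combining ideal star schemes. -/

section StarScheme

variable {V : Type*} {n : ℕ} (G : SimpleGraph V) (e : V ≃ Fin n) (p : ℕ) [NeZero p]

/-- The secret of the star scheme centred at the `i`-th vertex, when the secret of the whole scheme
is `z`. -/
def starSecret (z : ZMod p × ZMod p) (i : Fin n) : ZMod p :=
  z.1 + (i : ℕ) * z.2

open Classical in
/-- What the vertex `v` gets in the ideal star scheme centred at the `i`-th vertex. -/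
noncomputable def starShare (v : V) (ω : (ZMod p × ZMod p) × (Fin n → ZMod p)) (i : Fin n) :
    ZMod p :=
  if i = e v then ω.2 i else if G.Adj v (e.symm i) then ω.2 i + starSecret p ω.1 i else 0

/-- A coding of the elements of a countable type. -/
noncomputable def natCode (α : Type) [Countable α] : α → ℕ :=
  (exists_injective_nat α).choose

theorem natCode_injective (α : Type) [Countable α] : Function.Injective (natCode α) :=
  (exists_injective_nat α).choose_spec

/-- The combination of the ideal schemes on the stars of `G`, with a secret consisting of two
elements of `ZMod p`, any two stars determining the secret. -/
noncomputable def starScheme : Scheme V where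
  Ω := (ZMod p × ZMod p) × (Fin n → ZMod p)
  mΩ := ⊤
  P := @uniformOn _ ⊤ Set.univ
  isProb := @isProbabilityMeasure_uniformOn _ ⊤ (@MeasurableSingletonClass.mk _ ⊤ fun _ => trivial) _
    Set.finite_univ Set.univ_nonempty
  share v ω := natCode _ (starShare G e p v ω)
  secret ω := natCode _ ω.1
  measurable_share _ := measurable_from_top
  measurable_secret := measurable_from_top

theorem entropy_starScheme_secret :
    entropy (starScheme G e p).P (starScheme G e p).secret =
      2 * ENNReal.ofReal (Real.log p) := by
  let : MeasurableSpace ((ZMod p × ZMod p) × (Fin n → ZMod p)) := ⊤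
  have : MeasurableSingletonClass ((ZMod p × ZMod p) × (Fin n → ZMod p)) := ⟨fun _ => trivial⟩
  have h1 := entropy_comp_injective (P := (starScheme G e p).P)
    (fun ω : (ZMod p × ZMod p) × (Fin n → ZMod p) => ω.1) (natCode_injective (ZMod p × ZMod p))
  have h2 := entropy_uniformOn_univ_fst
    (Equiv.refl ((ZMod p × ZMod p) × (Fin n → ZMod p)))
  refine h1.trans (h2.trans ?_)
  rw [Fintype.card_prod, ZMod.card, Nat.cast_mul, ← pow_two, Real.log_pow,
    ENNReal.ofReal_mul (by norm_num)]
  simp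

/-- The share of `v` is constantly zero outside the stars centred at `v` or at a neighbour, so it is
a function of `G.degree v + 1` field elements. -/
theorem entropy_starScheme_share_le [Fintype V] [DecidableRel G.Adj] (v : V) :
    entropy (starScheme G e p).P ((starScheme G e p).share v) ≤
      (G.degree v + 1) * ENNReal.ofReal (Real.log p) := by
  classical
  let I := {i : Fin n // i ∈ (insert v (G.neighborFinset v)).map e.toEmbedding}
  have hcard : Fintype.card (I → ZMod p) = p ^ (G.degree v + 1) := by
    rw [Fintype.card_fun, ZMod.card, Fintype.card_coe, Finset.card_map,
      Finset.card_insert_of_notMem (by simp), SimpleGraph.card_neighborFinset_eq_degree]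
  have h := entropy_comp_le_log_card (P := (starScheme G e p).P)
    (U := fun ω => fun i : I => starShare G e p v ω i)
    (fun s => trivial)
    (fun z => natCode _ fun i =>
      if hi : i ∈ (insert v (G.neighborFinset v)).map e.toEmbedding then z ⟨i, hi⟩ else 0)
  rw [hcard, Nat.cast_pow, Real.log_pow, ENNReal.ofReal_mul (Nat.cast_nonneg _),
    ENNReal.ofReal_natCast, Nat.cast_add_one] at h
  refine le_trans (le_of_eq ?_) h
  congr 1
  funext ω
  change natCode _ _ = natCode _ _
  congr 1
  funext i
  split_ifs with hi
  · rfl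
  · simp only [Finset.mem_map_equiv, Finset.mem_insert, SimpleGraph.mem_neighborFinset,
      not_or] at hi
    exact (if_neg fun hie => hi.1 (by simp [hie])).trans (if_neg hi.2)

end StarScheme

theorem starScheme_realizes {V : Type*} {n : ℕ} (G : SimpleGraph V) (e : V ≃ Fin n) (p : ℕ)
    [Fact p.Prime] (hnp : n ≤ p) : (starScheme G e p).Realizes (graphAccess G) := by
  classical
  constructor
  · rintro A ⟨u, hu, v, hv, huv⟩
    have key : ∀ ω ω' : (starScheme G e p).Ω, (starScheme G e p).jointShare A ω =
        (starScheme G e p).jointShare A ω' →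
        (starScheme G e p).secret ω = (starScheme G e p).secret ω' := by
      rintro ω ω' h
      have hshare : ∀ w ∈ A, ∀ i, starShare G e p w ω i = starShare G e p w ω' i :=
        fun w hw => congrFun (natCode_injective _ (congrFun h ⟨w, hw⟩))
      -- In the star centred at `x`, the centre holds the mask and the leaf `y` holds mask plus star
      -- secret; subtracting unmasks it.
      have hsec : ∀ x ∈ A, ∀ y ∈ A, G.Adj x y →
          starSecret p ω.1 (e x) = starSecret p ω'.1 (e x) := by
        intro x hx y hy hxy
        have h1 := hshare x hx (e x)
        have h2 := hshare y hy (e x)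
        have hne : e x ≠ e y := fun h => hxy.ne (e.injective h)
        simp only [starShare, if_true] at h1
        simp only [starShare, if_neg hne, e.symm_apply_apply, if_pos hxy.symm, h1] at h2
        exact add_left_cancel h2
      have h1 := hsec u hu v hv huv
      have h2 := hsec v hv u hu huv.symm
      -- The size condition `n ≤ p` keeps the indices distinct modulo `p`, so the two star secrets
      -- form a nonsingular linear system for the pair.
      have hx : ((e u : ℕ) : ZMod p) - ((e v : ℕ) : ZMod p) ≠ 0 := by
        intro h0
        rw [sub_eq_zero, ZMod.natCast_eq_natCast_iff', Nat.mod_eq_of_lt ((e u).2.trans_le hnp),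
          Nat.mod_eq_of_lt ((e v).2.trans_le hnp)] at h0
        exact huv.ne (e.injective (Fin.ext h0))
      unfold starSecret at h1 h2
      have h3 : ω.1.2 = ω'.1.2 := by
        refine mul_left_cancel₀ hx ?_
        linear_combination h1 - h2
      have h4 : ω.1.1 = ω'.1.1 := by
        rw [h3] at h1
        exact add_right_cancel h1
      exact congrArg (natCode _) (Prod.ext h4 h3)
    refine ⟨Function.extend ((starScheme G e p).jointShare A) (starScheme G e p).secret 0,
      Filter.Eventually.of_forall fun ω => ?_⟩
    exact (Function.FactorsThrough.extend_apply (fun a b h => key a b h) 0 ω).symm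
  · intro A hA
    let : MeasurableSpace ((ZMod p × ZMod p) × (Fin n → ZMod p)) := ⊤
    have : MeasurableSingletonClass ((ZMod p × ZMod p) × (Fin n → ZMod p)) := ⟨fun _ => trivial⟩
    -- Absorb the star secret into the mask of every star whose centre is outside `A`. This is a
    -- bijection for each secret, so the new masks are uniform and independent of the secret. As `A`
    -- is independent, its shares depend on the new masks only: no leaf in `A` belongs to a star
    -- centred in `A`.
    let E : (ZMod p × ZMod p) × (Fin n → ZMod p) ≃ (ZMod p × ZMod p) × (Fin n → ZMod p) :=
      Equiv.prodShear (Equiv.refl _) fun z =>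
        Equiv.addRight fun i => if e.symm i ∈ A then 0 else starSecret p z i
    have h := indepFun_uniformOn_univ E
      (fun t => (fun v => natCode _ fun i =>
        if i = e v then t i else if G.Adj v (e.symm i) then t i else 0 : A → ℕ))
      (natCode (ZMod p × ZMod p))
    have hJ : (starScheme G e p).jointShare A = fun ω (v : A) => natCode _ fun i =>
        if i = e v then (E ω).2 i else if G.Adj v (e.symm i) then (E ω).2 i else 0 := by
      funext ω v
      change natCode _ (starShare G e p v ω) = natCode _ _
      congr 1
      funext i
      simp only [starShare, E, Equiv.prodShear_apply, Equiv.coe_addRight, Pi.add_apply]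
      split_ifs with h1 h2 h3 h4
      · rw [add_zero]
      · exact absurd v.2 (by simp [h1] at h2)
      · exact absurd ⟨v, v.2, _, h4, h3⟩ hA
      · rfl
      · rfl
    rw [hJ]
    exact h

/-- Stinson's bound for regular graphs. -/
theorem avgInfoRatio_le_of_isRegularOfDegree {V : Type*} [Fintype V] [Nonempty V]
    {G : SimpleGraph V} [DecidableRel G.Adj] {δ : ℕ} (hG : G.IsRegularOfDegree δ) :
    avgInfoRatio G ≤ (δ + 1) / 2 := by
  obtain ⟨p, hp, hprime⟩ := Nat.exists_infinite_primes (Fintype.card V)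
  have : Fact p.Prime := ⟨hprime⟩
  let e := Fintype.equivFin V
  have hL0 : ENNReal.ofReal (Real.log p) ≠ 0 := by
    rw [Ne, ENNReal.ofReal_eq_zero, not_le]
    exact Real.log_pos (by exact_mod_cast hprime.one_lt)
  have hn0 : (Fintype.card V : ℝ≥0∞) ≠ 0 := by exact_mod_cast Fintype.card_ne_zero
  have hsec := entropy_starScheme_secret G e p
  unfold avgInfoRatio
  refine iInf_le_of_le (starScheme G e p) (iInf_le_of_le (starScheme_realizes G e p hp)
    (iInf_le_of_le (by rw [hsec]; simp [hL0]) (iInf_le_of_le (by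
      rw [hsec]; exact ENNReal.mul_ne_top (by simp) ENNReal.ofReal_ne_top) ?_)))
  rw [hsec]
  set L := ENNReal.ofReal (Real.log p)
  calc _ ≤ ∑ v : V, ((δ + 1) * L) / (2 * L * Fintype.card V) := by
        refine Finset.sum_le_sum fun v _ => ENNReal.div_le_div_right ?_ _
        have := entropy_starScheme_share_le G e p v
        rwa [hG.degree_eq v] at this
    _ = ((δ + 1) * (L * Fintype.card V)) / (2 * (L * Fintype.card V)) := by
        rw [Finset.sum_const, Finset.card_univ, nsmul_eq_mul, ← mul_div_assoc]
        congr 1 <;> ring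
    _ = (δ + 1) / 2 := by
        rw [ENNReal.mul_div_mul_right _ _ (mul_ne_zero hL0 hn0)
          (ENNReal.mul_ne_top ENNReal.ofReal_ne_top (by simp))]
    _ ≤ _ := le_rfl

/-! ### The lower bound, regularity and conclusion. -/

theorem le_avgInfoRatio {V : Type*} [Fintype V] [Nonempty V] {G : SimpleGraph V} {r : ℝ≥0∞}
    (hr : r ≠ ∞) (h : ∀ f, IsGraphRank G f → r.toReal * Fintype.card V ≤ ∑ v, f {v}) :
    r ≤ avgInfoRatio G := by
  unfold avgInfoRatio
  refine le_iInf fun S => le_iInf fun hS => le_iInf fun h0 => le_iInf fun h1 => ?_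
  have hn0 : (Fintype.card V : ℝ≥0∞) ≠ 0 := by exact_mod_cast Fintype.card_ne_zero
  have hne : entropy S.P S.secret * Fintype.card V ≠ ∞ := ENNReal.mul_ne_top h1 (by simp)
  simp only [div_eq_mul_inv]
  rw [← Finset.sum_mul, ← div_eq_mul_inv,
    ENNReal.le_div_iff_mul_le (Or.inl (mul_ne_zero h0 hn0)) (Or.inl hne)]
  -- Real-valued rank functions need finite share entropies; if one is infinite, so is the sum to be
  -- bounded below.
  by_cases hfin : ∀ v, entropy S.P (S.share v) ≠ ∞
  · have hpos : 0 < (entropy S.P S.secret).toReal := ENNReal.toReal_pos h0 h1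
    have hr' := h _ (hS.isGraphRank h0 h1 hfin)
    simp only [Scheme.entropy_jointShare_singleton] at hr'
    rw [← Finset.sum_div, le_div_iff₀ hpos, ← ENNReal.toReal_sum fun v _ => hfin v] at hr'
    rw [← ENNReal.toReal_le_toReal (ENNReal.mul_ne_top hr hne)
      (ENNReal.sum_ne_top.2 fun v _ => hfin v), ENNReal.toReal_mul, ENNReal.toReal_mul,
      ENNReal.toReal_natCast]
    linarith
  · push Not at hfin
    obtain ⟨v, hv⟩ := hfin
    rw [ENNReal.sum_eq_top.2 ⟨v, Finset.mem_univ v, hv⟩]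
    exact le_top

section CubeTriple

variable {d : ℕ} {A : Fin 3 → Set (Fin d → Bool)}
  {M : (i : Fin 3) → A i ≃ ((A (i + 1))ᶜ : Set (Fin d → Bool))}

/-- The vertex `m` is the matching partner: in the next cube for vertices of `A`, in the previous
one for the others. -/
theorem cubeTriple_neighborSet (w : Fin 3 × (Fin d → Bool)) :
    ∃ m : Fin 3 × (Fin d → Bool), m.1 ≠ w.1 ∧
      (cubeTriple d A M).neighborSet w = insert m (Set.range fun k => (w.1, flip k w.2)) := by
  have n1 : ∀ j : Fin 3, j + 1 ≠ j := by decide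
  obtain ⟨i, x⟩ := w
  obtain ⟨j, rfl⟩ : ∃ j, i = j + 1 := ⟨i - 1, by simp⟩
  by_cases hx : x ∈ A (j + 1)
  · refine ⟨(j + 1 + 1, M (j + 1) ⟨x, hx⟩), n1 _, ?_⟩
    ext ⟨k, y⟩
    simp only [SimpleGraph.mem_neighborSet, Set.mem_insert_iff, Set.mem_range, Prod.mk.injEq]
    constructor
    · rintro (⟨h, h'⟩ | ⟨h, h', h''⟩ | ⟨h, h', h''⟩)
      · obtain ⟨l, hl⟩ := cube_adj_iff.1 h'
        exact Or.inr ⟨l, h, hl.symm⟩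
      · exact Or.inl ⟨h, h''.symm⟩
      · have hkj : j = k := add_right_cancel h
        subst hkj
        exact absurd (h'' ▸ hx : ((M j ⟨y, h'⟩ : Fin d → Bool)) ∈ A (j + 1)) (M j ⟨y, h'⟩).2
    · rintro (⟨rfl, rfl⟩ | ⟨l, rfl, rfl⟩)
      · exact Or.inr (Or.inl ⟨rfl, hx, rfl⟩)
      · exact Or.inl ⟨rfl, cube_adj_iff.2 ⟨l, rfl⟩⟩
  · refine ⟨(j, (M j).symm ⟨x, hx⟩), (n1 _).symm, ?_⟩
    ext ⟨k, y⟩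
    simp only [SimpleGraph.mem_neighborSet, Set.mem_insert_iff, Set.mem_range, Prod.mk.injEq]
    constructor
    · rintro (⟨h, h'⟩ | ⟨h, h', h''⟩ | ⟨h, h', h''⟩)
      · obtain ⟨l, hl⟩ := cube_adj_iff.1 h'
        exact Or.inr ⟨l, h, hl.symm⟩
      · exact absurd h' hx
      · have hkj : j = k := add_right_cancel h
        subst hkj
        have : (⟨x, hx⟩ : ((A (j + 1))ᶜ : Set (Fin d → Bool))) = M j ⟨y, h'⟩ :=
          Subtype.ext h''.symm
        rw [this, Equiv.symm_apply_apply]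
        exact Or.inl ⟨rfl, rfl⟩
    · rintro (⟨rfl, rfl⟩ | ⟨l, rfl, rfl⟩)
      · exact Or.inr (Or.inr ⟨rfl, Subtype.coe_prop _, by simp⟩)
      · exact Or.inl ⟨rfl, cube_adj_iff.2 ⟨l, rfl⟩⟩

theorem ncard_cubeTriple_neighborSet (w : Fin 3 × (Fin d → Bool)) :
    ((cubeTriple d A M).neighborSet w).ncard = d + 1 := by
  obtain ⟨m, hm, h⟩ := cubeTriple_neighborSet (M := M) w
  rw [h, Set.ncard_insert_of_notMem, ← Set.image_univ, Set.ncard_image_of_injective,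
    Set.ncard_univ, Nat.card_fin]
  · exact fun k l hkl => flip_injective_direction (Prod.mk.inj hkl).2
  · rintro ⟨k, rfl⟩
    exact hm rfl

end CubeTriple

namespace InDelta

variable {V : Type*} [Fintype V] {d : ℕ} {D : SimpleGraph V}

theorem card_eq (hD : InDelta d D) : Fintype.card V = 3 * 2 ^ d := by
  obtain ⟨A, M, -, ⟨φ⟩⟩ := hD
  simp [Fintype.card_congr φ.toEquiv]

theorem isRegularOfDegree [DecidableRel D.Adj] (hD : InDelta d D) :
    D.IsRegularOfDegree (d + 1) := by
  obtain ⟨A, M, -, ⟨φ⟩⟩ := hD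
  intro v
  rw [← SimpleGraph.card_neighborSet_eq_degree, ← Nat.card_eq_fintype_card,
    Nat.card_congr (φ.mapNeighborSet v)]
  exact ncard_cubeTriple_neighborSet (φ v)

theorem le_avgInfoRatio (hD : InDelta d D) : ((d : ℝ≥0∞) + 2) / 2 ≤ avgInfoRatio D := by
  have hcard := hD.card_eq
  have : Nonempty V := Fintype.card_pos_iff.1 (by rw [hcard]; positivity)
  obtain ⟨A, M, hA, ⟨φ⟩⟩ := hD
  refine SecretSharing.le_avgInfoRatio (ENNReal.div_ne_top (by simp) (by simp)) fun f hf => ?_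
  have h := le_sum_cubeTriple hA (hf.comap φ)
  rw [← φ.toEquiv.sum_comp] at h
  have e : ∀ v, φ ⁻¹' {φ.toEquiv v} = {v} := fun v => by ext w; simp
  simp only [e] at h
  rw [ENNReal.toReal_div, ENNReal.toReal_add (by simp) (by simp), hcard]
  push_cast
  simp only [ENNReal.toReal_natCast, ENNReal.toReal_ofNat]
  linarith

end InDelta

end SecretSharing

theorem theorem3p5 {V : Type*} [Fintype V] (δ : ℕ) (hδ : 2 ≤ δ) (D : SimpleGraph V)
    [DecidableRel D.Adj] (hD : SecretSharing.InDelta (δ - 1) D) :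
    D.IsRegularOfDegree δ ∧ Fintype.card V = 3 * 2 ^ (δ - 1) ∧
      SecretSharing.avgInfoRatio D = ((δ : ℝ≥0∞) + 1) / 2 := by
  obtain ⟨d, rfl⟩ : ∃ d, δ = d + 1 := ⟨δ - 1, by omega⟩
  rw [Nat.add_sub_cancel] at hD ⊢
  have hcard := hD.card_eq
  have : Nonempty V := Fintype.card_pos_iff.1 (by rw [hcard]; positivity)
  refine ⟨hD.isRegularOfDegree, hcard,
    le_antisymm (SecretSharing.avgInfoRatio_le_of_isRegularOfDegree hD.isRegularOfDegree) ?_⟩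
  refine le_of_eq_of_le ?_ hD.le_avgInfoRatio
  push_cast
  rw [add_assoc, one_add_one_eq_two]
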